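/- Let $n\ge 3$. For $t=(t_{i,j,k}\mid 1\le i<j<k\le n)\in\mathbb Z^{\binom n3}$ let \[ G(t)=\langle a_1,\dots,a_n \mid a_ja_i=a_ia_j\,a_{j+1}^{t_{i,j,j+1}}\cdots a_n^{t_{i,j,n}} \text{ for } 1\le i<j\le n\rangle, \] and let $\mathcal C_n$ be the set of all $t$ for which $G(t)$ is consistent, that is, has Hirsch length exactly $n$ (the Hirsch length is the number of infinite factors in a finite subnormal series with cyclic factors). Let $T=(T_{i,j,k}\mid 1\le i<j<k\le n)$ be indeterminates. Then the following hold. 1. For all $t\in\mathcal C_n$ and $v\in\mathbb Z$ there are unique integers $R_{1,2,k}(t;1,v)$, $3\le k\le n$, with \[ a_2a_1^v=a_1^va_2\,a_3^{R_{1,2,3}(t;1,v)}\cdots a_n^{R_{1,2,n}(t;1,v)} \quad\text{in } G(t). \] 2. There is a polynomial $g=g(T;v)\in\mathbb Q[T][v]$, the same for all $t$, such that \[ R_{1,2,n}(t;1,v+1)=R_{1,2,n}(t;1,v)+g(t;v)\qquad\text{for all } t\in\mathcal C_n,\ v\in\mathbb Z. \] 3. $R_{1,2,n}(t;1,0)=0$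 for all $t\in\mathcal C_n$. 4. For every $g=c_0+c_1v+\cdots+c_lv^l\in\mathbb Q[T][v]$ of degree $l$ in $v$ (with $l=0$ if $g=0$) as in 2, the polynomial $f=f_1v+\cdots+f_{l+1}v^{l+1}\in\mathbb Q[T][v]$ with \[ f_m=\sum_{k=0}^{l+1-m}\frac{c_{m+k-1}}{m+k}\,B_k\binom{m+k}{k}\qquad(1\le m\le l+1), \] where $B_0=1$, $B_1=-\tfrac12$, $B_2=\tfrac16,\dots$ are the Bernoulli numbers, satisfies $f(T;0)=0$ and $f(T;v+1)=f(T;v)+g(T;v)$, and it describes the conjugation function: \[ R_{1,2,n}(t;1,v)=f(t;v)\qquad\text{for all } t\in\mathcal C_n,\ v\in\mathbb Z. \] -/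

import Mathlib

namespace HallPoly

/-- A finite subnormal series `G = G₀ ⊵ G₁ ⊵ ⋯ ⊵ G_m = 1` with cyclic factors. -/
structure CyclicSeries (G : Type*) [Group G] where
  length : ℕ
  term : Fin (length + 1) → Subgroup G
  term_zero : term 0 = ⊤
  term_last : term (Fin.last length) = ⊥
  term_le : ∀ i : Fin length, term i.succ ≤ term i.castSucc
  normal : ∀ i : Fin length, ((term i.succ).subgroupOf (term i.castSucc)).Normal
  cyclic : ∀ i : Fin length,
    IsCyclic (term i.castSucc ⧸ (term i.succ).subgroupOf (term i.castSucc))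

/-- The number of infinite factors of a series with cyclic factors. -/
noncomputable def CyclicSeries.numInfinite {G : Type*} [Group G] (S : CyclicSeries G) : ℕ :=
  {i : Fin S.length |
    Infinite (S.term i.castSucc ⧸ (S.term i.succ).subgroupOf (S.term i.castSucc))}.ncard

/-- The Hirsch length of a polycyclic group: the number of infinite factors in a series with
cyclic factors. This number is the same for all such series; taking the least one avoids
choosing a series. -/
noncomputable def hirschLength (G : Type*) [Group G] : ℕ :=
  sInf (Set.range (CyclicSeries.numInfinite (G := G)))

/-- The index triples `i < j < k` of the parameters (`Fin n` counts from `0`). -/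
abbrev ParamIndex (n : ℕ) : Type :=
  {p : Fin n × Fin n × Fin n // p.1 < p.2.1 ∧ p.2.1 < p.2.2}

/-- The ordered product `a_{j+1}^{r_{j+1}} ⋯ a_n^{r_n}`. -/
def tailProd {n : ℕ} {G : Type*} [Group G] (a : Fin n → G) (j : Fin n)
    (r : {k : Fin n // j < k} → ℤ) : G :=
  (List.ofFn fun k : Fin n => if h : j < k then a k ^ r ⟨k, h⟩ else 1).prod

/-- The relators `a_j a_i (a_i a_j a_{j+1}^{t_{i,j,j+1}} ⋯ a_n^{t_{i,j,n}})⁻¹`, `i < j`. -/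
def relators {n : ℕ} (t : ParamIndex n → ℤ) : Set (FreeGroup (Fin n)) :=
  {w | ∃ (i j : Fin n) (hij : i < j),
    w = FreeGroup.of j * FreeGroup.of i *
      (FreeGroup.of i * FreeGroup.of j *
        tailProd FreeGroup.of j (fun k => t ⟨(i, j, k.1), hij, k.2⟩))⁻¹}

/-- The group `G(t)`. -/
abbrev NilpGroup {n : ℕ} (t : ParamIndex n → ℤ) : Type := PresentedGroup (relators t)

/-- The generators `a_i` of `G(t)`. -/
def gen {n : ℕ} (t : ParamIndex n → ℤ) (i : Fin n) : NilpGroup t := PresentedGroup.of i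

/-- The set `𝒞_n` of all `t` for which `G(t)` is consistent. -/
def consistentParams (n : ℕ) : Set (ParamIndex n → ℤ) :=
  {t | hirschLength (NilpGroup t) = n}

/-- `r` is a vector of exponents with
`a_j^u a_i^v = a_i^v a_j^u a_{j+1}^{r_{j+1}} ⋯ a_n^{r_n}` in `G(t)`. -/
def IsConjExponents {n : ℕ} (t : ParamIndex n → ℤ) (i j : Fin n) (u v : ℤ)
    (r : {k : Fin n // j < k} → ℤ) : Prop :=
  gen t j ^ u * gen t i ^ v = gen t i ^ v * gen t j ^ u * tailProd (gen t) j r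

/-- The conjugation functions: `conjFun t i j u v ⟨k, _⟩` is `R_{i,j,k}(t;u,v)`, determined by its
defining equation `IsConjExponents` (uniquely if `t` is consistent and `i < j`). -/
noncomputable def conjFun {n : ℕ} (t : ParamIndex n → ℤ) (i j : Fin n) (u v : ℤ) :
    {k : Fin n // j < k} → ℤ :=
  Classical.epsilon (IsConjExponents t i j u v)

/-- The index `1`, in the numbering from `1`. -/
def idxOne {n : ℕ} (hn : 3 ≤ n) : Fin n := ⟨0, by omega⟩

/-- The index `2`, in the numbering from `1`. -/
def idxTwo {n : ℕ} (hn : 3 ≤ n) : Fin n := ⟨1, by omega⟩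

/-- The index `n`, in the numbering from `1`, as an index larger than `2`. -/
def idxLast {n : ℕ} (hn : 3 ≤ n) : {k : Fin n // idxTwo hn < k} :=
  ⟨⟨n - 1, by omega⟩, by simp only [idxTwo, Fin.mk_lt_mk]; omega⟩

/-- `R_{1,2,n}(t;1,v)`. -/
noncomputable def lastConj {n : ℕ} (hn : 3 ≤ n) (t : ParamIndex n → ℤ) (v : ℤ) : ℤ :=
  conjFun t (idxOne hn) (idxTwo hn) 1 v (idxLast hn)

/-- The value `g(t; v)` of `g ∈ ℚ[T][v]` at integral parameters `t` and an integer `v`. -/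
noncomputable def evalAt {n : ℕ} (g : Polynomial (MvPolynomial (ParamIndex n) ℚ))
    (t : ParamIndex n → ℤ) (v : ℤ) : ℚ :=
  (g.map (MvPolynomial.eval fun p => (t p : ℚ))).eval (v : ℚ)

/-- For `g = c₀ + ⋯ + c_l x^l`, the polynomial `f = f₀ + f₁ x + ⋯ + f_{l+1} x^{l+1}` with
`f_m = ∑_{k=0}^{l+1-m} c_{m+k-1} / (m+k) * B_k * (m+k choose k)` for `m > 0`. -/
noncomputable def bernoulliSolution {R : Type*} [CommRing R] [Algebra ℚ R] (f₀ : R)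
    (g : Polynomial R) : Polynomial R :=
  Polynomial.C f₀ + ∑ m ∈ Finset.Icc 1 (g.natDegree + 1),
    Polynomial.C (∑ k ∈ Finset.range (g.natDegree + 1 - m + 1),
      (bernoulli k * ((m + k).choose k : ℚ) / ((m + k : ℕ) : ℚ)) • g.coeff (m + k - 1)) *
      Polynomial.X ^ m

end HallPoly

/-! With `U_k` the subgroup generated by `a_k, a_{k+1}, …`, the relations make every factor `U_k /
U_{k+1}` cyclic and central in `G / U_{k+1}`. Consistency makes these factors infinite, so normal
forms are unique and every group element has well-defined integer coordinates.

The core is a form of Hall's theorem (`PolyData.closedAt`): for families of such groups with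
polynomial parameters, products and powers of elements with polynomial coordinates again have
polynomial coordinates. It is proved by descending induction on the tail `U_j`. Collecting `a_j ^ r
u a_j ^ s w` needs `u` conjugated by `a_j ^ s`. Both this conjugate and powers `g ^ v` satisfy a
recursion `c(v + 1) = b₁ c(v) b₂`. Modulo `U_{k+1}` the `k`-th coordinate of `c(v)` is central, so
its increment depends only on the lower coordinates (`isPoly_of_recursion`). A function on `ℤ` with
polynomial increments and given initial value is polynomial, with Bernoulli numbers giving the
solution (`mem_polyExtension_of_differences`).

The exponents `R_{1,2,k}` are the coordinates of the commutator `a_2⁻¹ a_1⁻ᵛ a_2 a_1ᵛ`. Hence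
`R_{1,2,n}` is given by some polynomial `f`, and `g` can be taken as `f(v + 1) - f(v)`. Conversely,
for any admissible `g` the Bernoulli solution has the same increments and value at `0` as
`R_{1,2,n}`, so the two agree on `ℤ`. -/

namespace HallPoly

/-! ### Tail subgroups, their central factors, and normal forms -/

section Sequences

variable {G : Type*} [Group G]

/-- The product `a₀ ^ e₀ ⋯ a_{k-1} ^ e_{k-1}`. -/
def orderedProd (a : ℕ → G) (e : ℕ → ℤ) : ℕ → G
  | 0 => 1
  | k + 1 => orderedProd a e k * a k ^ e k

/-- The subgroup generated by `a_k, a_{k+1}, …`. -/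
def tailSubgroup (a : ℕ → G) (k : ℕ) : Subgroup G := Subgroup.closure (a '' Set.Ici k)

/-- The `a_k` with `k < n` generate `G` and satisfy the relations
`a_j a_i = a_i a_j a_{j+1}^{t i j (j+1)} ⋯ a_{n-1}^{t i j (n-1)}` for `i < j`. -/
structure IsNilpotentSequence (a : ℕ → G) (n : ℕ) (t : ℕ → ℕ → ℕ → ℤ) : Prop where
  tail_zero : tailSubgroup a 0 = ⊤
  eq_one : ∀ k, n ≤ k → a k = 1
  rel : ∀ i j, i < j → j < n → a j * a i = a i * a j * orderedProd a (t i j) n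
  param_eq_zero : ∀ i j k, k ≤ j → t i j k = 0

variable {a : ℕ → G} {n : ℕ} {t : ℕ → ℕ → ℕ → ℤ}

theorem orderedProd_congr {b : ℕ → G} {e f : ℕ → ℤ} {m : ℕ}
    (h : ∀ i < m, a i ^ e i = b i ^ f i) : orderedProd a e m = orderedProd b f m := by
  induction m with
  | zero => rfl
  | succ m ih =>
    simp only [orderedProd]
    rw [ih fun i hi => h i (by omega), h m (by omega)]

theorem orderedProd_eq_one {e : ℕ → ℤ} {m : ℕ} (h : ∀ i < m, e i = 0) :
    orderedProd a e m = 1 := by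
  induction m with
  | zero => rfl
  | succ m ih =>
    simp only [orderedProd]
    rw [ih fun i hi => h i (by omega), h m (by omega), zpow_zero, mul_one]

theorem map_orderedProd {H : Type*} [Group H] (φ : G →* H) (e : ℕ → ℤ) (m : ℕ) :
    φ (orderedProd a e m) = orderedProd (fun k => φ (a k)) e m := by
  induction m with
  | zero => simp [orderedProd]
  | succ m ih => simp [orderedProd, ih]

theorem orderedProd_truncate (e : ℕ → ℤ) {k m : ℕ} (h : k ≤ m) :
    orderedProd a (fun i => if i < k then e i else 0) m = orderedProd a e k := by
  induction m, h using Nat.le_induction with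
  | base => exact orderedProd_congr fun i hi => by simp [hi]
  | succ m hm ih => simp [orderedProd, ih, Nat.not_lt.mpr hm]

theorem orderedProd_split {e : ℕ → ℤ} {j m : ℕ} (h : ∀ i < j, e i = 0) (hj : j < m) :
    orderedProd a e m =
      a j ^ e j * orderedProd a (fun i => if i ≤ j then 0 else e i) m := by
  induction m, Nat.succ_le_of_lt hj using Nat.le_induction with
  | base =>
    rw [orderedProd, orderedProd_eq_one h, orderedProd_eq_one fun i hi => by
      simp [Nat.le_of_lt_succ hi], one_mul, mul_one]
  | succ m hm ih =>
    rw [orderedProd, ih (by omega), orderedProd, if_neg (by omega), mul_assoc]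

theorem orderedProd_single {j m : ℕ} (s : ℤ) (hj : j < m) :
    orderedProd a (Pi.single j s) m = a j ^ s := by
  rw [orderedProd_split (fun i hi => Pi.single_eq_of_ne hi.ne _) hj, Pi.single_eq_same,
    orderedProd_eq_one, mul_one]
  intro i _
  split_ifs with h
  · rfl
  · exact Pi.single_eq_of_ne (by omega) _

theorem mem_tailSubgroup {i k : ℕ} (h : k ≤ i) : a i ∈ tailSubgroup a k :=
  Subgroup.subset_closure ⟨i, h, rfl⟩

theorem tailSubgroup_antitone : Antitone (tailSubgroup a) := fun _ _ h =>
  Subgroup.closure_mono (Set.image_mono (Set.Ici_subset_Ici.mpr h))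

theorem tailSubgroup_le_iff {k : ℕ} {H : Subgroup G} :
    tailSubgroup a k ≤ H ↔ a k ∈ H ∧ tailSubgroup a (k + 1) ≤ H := by
  constructor
  · exact fun h => ⟨h (mem_tailSubgroup le_rfl), (tailSubgroup_antitone (Nat.le_succ k)).trans h⟩
  · rintro ⟨h1, h2⟩
    refine (Subgroup.closure_le H).mpr ?_
    rintro _ ⟨i, hi, rfl⟩
    rcases (Set.mem_Ici.mp hi).eq_or_lt with rfl | hlt
    · exact h1
    · exact h2 (mem_tailSubgroup hlt)

theorem orderedProd_mem {e : ℕ → ℤ} {H : Subgroup G} {m : ℕ}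
    (h : ∀ i < m, a i ^ e i ∈ H) : orderedProd a e m ∈ H := by
  induction m with
  | zero => exact H.one_mem
  | succ m ih => exact H.mul_mem (ih fun i hi => h i (by omega)) (h m (by omega))

theorem orderedProd_mem_tail {e : ℕ → ℤ} {j m : ℕ} (h : ∀ i < j, e i = 0) :
    orderedProd a e m ∈ tailSubgroup a j :=
  orderedProd_mem fun i _ => by
    rcases lt_or_ge i j with hi | hi
    · rw [h i hi, zpow_zero]; exact Subgroup.one_mem _
    · exact Subgroup.zpow_mem _ (mem_tailSubgroup hi) _

theorem inv_orderedProd_mul_mem (e : ℕ → ℤ) {k m : ℕ} (h : k ≤ m) :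
    (orderedProd a e k)⁻¹ * orderedProd a e m ∈ tailSubgroup a k := by
  induction m, h using Nat.le_induction with
  | base => simp
  | succ m hm ih =>
    rw [orderedProd, ← mul_assoc]
    exact Subgroup.mul_mem _ ih (Subgroup.zpow_mem _ (mem_tailSubgroup hm) _)

namespace IsNilpotentSequence

theorem tail_eq_bot (ha : IsNilpotentSequence a n t) {k : ℕ} (hk : n ≤ k) :
    tailSubgroup a k = ⊥ := by
  rw [eq_bot_iff]
  refine (Subgroup.closure_le _).mpr ?_
  rintro _ ⟨i, hi, rfl⟩
  exact ha.eq_one i (hk.trans hi)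

theorem orderedProd_rel_mem (ha : IsNilpotentSequence a n t) (i j : ℕ) :
    orderedProd a (t i j) n ∈ tailSubgroup a (j + 1) :=
  orderedProd_mem_tail fun k hk => ha.param_eq_zero i j k (by omega)

/-- Modulo `U_{k+1}` the generators after `a_k` vanish, and the tail in the relation between `a_i`
and `a_k`, `i < k`, vanishes too. So `a_k` commutes with all generators, and its image, which
generates that of `U_k`, is central. -/
theorem tail_central_of_normal (ha : IsNilpotentSequence a n t) {k : ℕ} (hk : k < n)
    [hN : (tailSubgroup a (k + 1)).Normal] (g : G) {r : G} (hr : r ∈ tailSubgroup a k) :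
    g⁻¹ * r⁻¹ * g * r ∈ tailSubgroup a (k + 1) := by
  let q := QuotientGroup.mk' (tailSubgroup a (k + 1))
  have key : ∀ g r : G, g⁻¹ * r⁻¹ * g * r ∈ tailSubgroup a (k + 1) ↔ Commute (q r) (q g) := by
    intro g r
    rw [← QuotientGroup.eq_one_iff]
    change q (g⁻¹ * r⁻¹ * g * r) = 1 ↔ _
    rw [map_mul, map_mul, map_mul, map_inv, map_inv, commute_iff_eq]
    constructor
    · intro h
      have : q r * q g * ((q g)⁻¹ * (q r)⁻¹ * q g * q r) = q r * q g := by rw [h, mul_one]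
      rw [← this]; group
    · intro h
      rw [mul_assoc, ← h]; group
  have kill : ∀ x ∈ tailSubgroup a (k + 1), q x = 1 := fun x hx =>
    (QuotientGroup.eq_one_iff x).mpr hx
  have hgen : ∀ g : G, Commute (q (a k)) (q g) := by
    intro g
    have hle : tailSubgroup a 0 ≤ (Subgroup.centralizer {q (a k)}).comap q := by
      refine (Subgroup.closure_le _).mpr ?_
      rintro _ ⟨i, -, rfl⟩
      simp only [SetLike.mem_coe, Subgroup.mem_comap, Subgroup.mem_centralizer_singleton_iff]
      rcases lt_trichotomy i k with h | rfl | h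
      · have h1 := congrArg q (ha.rel i k h hk)
        rw [map_mul, map_mul, map_mul, kill _ (ha.orderedProd_rel_mem i k), mul_one] at h1
        exact h1.symm
      · rfl
      · rw [kill (a i) (mem_tailSubgroup h), one_mul, mul_one]
    rw [ha.tail_zero] at hle
    have := hle (Subgroup.mem_top g)
    simp only [Subgroup.mem_comap, Subgroup.mem_centralizer_singleton_iff] at this
    exact this.symm
  have hcen : tailSubgroup a k ≤ (Subgroup.center _).comap q := by
    refine tailSubgroup_le_iff.mpr ⟨?_, fun x hx => ?_⟩
    · rw [Subgroup.mem_comap, Subgroup.mem_center_iff]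
      intro y
      obtain ⟨g, rfl⟩ := QuotientGroup.mk'_surjective _ y
      exact (hgen g).symm
    · rw [Subgroup.mem_comap, kill x hx]
      exact Subgroup.one_mem _
  rw [key]
  exact ((Subgroup.mem_center_iff.mp (hcen hr)) (q g)).symm

theorem tail_normal (ha : IsNilpotentSequence a n t) (k : ℕ) : (tailSubgroup a k).Normal := by
  rcases le_total n k with h | h
  · rw [ha.tail_eq_bot h]; infer_instance
  · induction h using Nat.decreasingInduction with
    | self => rw [ha.tail_eq_bot le_rfl]; infer_instance
    | of_succ k hk ih =>
      refine ⟨fun r hr g => ?_⟩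
      -- This is the commutator `g r g⁻¹ r⁻¹`; multiplying by `r` gives the conjugate.
      have h1 := tailSubgroup_antitone (Nat.le_succ k)
        (ha.tail_central_of_normal hk g⁻¹ (Subgroup.inv_mem _ hr))
      have h2 := Subgroup.mul_mem _ h1 hr
      convert h2 using 1
      group

/-- The factor `U_k / U_{k+1}` of the tail subgroups is central. -/
theorem tail_central (ha : IsNilpotentSequence a n t) {k : ℕ} (g : G) {r : G}
    (hr : r ∈ tailSubgroup a k) : g⁻¹ * r⁻¹ * g * r ∈ tailSubgroup a (k + 1) := by
  rcases lt_or_ge k n with h | h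
  · have := ha.tail_normal (k + 1)
    exact ha.tail_central_of_normal h g hr
  · rw [ha.tail_eq_bot h, Subgroup.mem_bot] at hr
    simp [hr]

theorem exists_zpow_mul_mem (ha : IsNilpotentSequence a n t) {k : ℕ} {r : G}
    (hr : r ∈ tailSubgroup a k) : ∃ s : ℤ, (a k ^ s)⁻¹ * r ∈ tailSubgroup a (k + 1) := by
  have := ha.tail_normal (k + 1)
  have h : tailSubgroup a k ≤ Subgroup.zpowers (a k) ⊔ tailSubgroup a (k + 1) :=
    tailSubgroup_le_iff.mpr
      ⟨Subgroup.mem_sup_left (Subgroup.mem_zpowers _), le_sup_right⟩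
  obtain ⟨y, ⟨s, rfl⟩, z, hz, rfl⟩ := Subgroup.mem_sup_of_normal_right.mp (h hr)
  exact ⟨s, by simpa using hz⟩

theorem exists_orderedProd (ha : IsNilpotentSequence a n t) (g : G) (k : ℕ) :
    ∃ e : ℕ → ℤ, (orderedProd a e k)⁻¹ * g ∈ tailSubgroup a k := by
  induction k with
  | zero => exact ⟨0, by rw [ha.tail_zero]; exact Subgroup.mem_top _⟩
  | succ k ih =>
    obtain ⟨e, he⟩ := ih
    obtain ⟨s, hs⟩ := ha.exists_zpow_mul_mem he
    refine ⟨Function.update e k s, ?_⟩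
    have h1 : orderedProd a (Function.update e k s) k = orderedProd a e k :=
      orderedProd_congr fun i hi => by rw [Function.update_of_ne hi.ne]
    simpa [orderedProd, h1, mul_assoc] using hs

end IsNilpotentSequence

/-- A sequence as in `IsNilpotentSequence` whose tail subgroups have infinite factors. -/
structure IsConsistentSequence (a : ℕ → G) (n : ℕ) (t : ℕ → ℕ → ℕ → ℤ) : Prop
    extends IsNilpotentSequence a n t where
  zpow_mem : ∀ k < n, ∀ s : ℤ, a k ^ s ∈ tailSubgroup a (k + 1) → s = 0

/-- The exponents of the normal form `a₀ ^ e₀ ⋯ a_{n-1} ^ e_{n-1}` of `g`. -/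
noncomputable def coord (a : ℕ → G) (n : ℕ) (g : G) : ℕ → ℤ :=
  Classical.epsilon fun e => (∀ i, n ≤ i → e i = 0) ∧ orderedProd a e n = g

namespace IsNilpotentSequence

theorem coord_spec (ha : IsNilpotentSequence a n t) (g : G) :
    (∀ i, n ≤ i → coord a n g i = 0) ∧ orderedProd a (coord a n g) n = g := by
  apply Classical.epsilon_spec (p := fun e : ℕ → ℤ => (∀ i, n ≤ i → e i = 0) ∧
    orderedProd a e n = g)
  obtain ⟨e, he⟩ := ha.exists_orderedProd g n
  rw [ha.tail_eq_bot le_rfl, Subgroup.mem_bot, inv_mul_eq_one] at he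
  exact ⟨fun i => if i < n then e i else 0, fun i hi => by simp [Nat.not_lt.mpr hi],
    by rw [orderedProd_truncate e le_rfl, he]⟩

theorem coord_of_le (ha : IsNilpotentSequence a n t) (g : G) {i : ℕ} (hi : n ≤ i) :
    coord a n g i = 0 := (ha.coord_spec g).1 i hi

theorem orderedProd_coord (ha : IsNilpotentSequence a n t) (g : G) :
    orderedProd a (coord a n g) n = g := (ha.coord_spec g).2

end IsNilpotentSequence

namespace IsConsistentSequence

/-- Modulo `U_m` the last factors disappear, so the earlier exponents agree by induction. Cancelling
them leaves a power of `a_m` in `U_{m+1}`, whose exponent is `0` by consistency. -/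
theorem exponents_unique (ha : IsConsistentSequence a n t) {e f : ℕ → ℤ} {m : ℕ} (hm : m ≤ n)
    (h : (orderedProd a e m)⁻¹ * orderedProd a f m ∈ tailSubgroup a m) :
    ∀ i < m, e i = f i := by
  induction m with
  | zero => intro i hi; omega
  | succ m ih =>
    have hmem : ∀ s : ℤ, a m ^ s ∈ tailSubgroup a m := fun s =>
      Subgroup.zpow_mem _ (mem_tailSubgroup le_rfl) s
    have h1 : (orderedProd a e m)⁻¹ * orderedProd a f m ∈ tailSubgroup a m := by
      have := Subgroup.mul_mem _ (Subgroup.mul_mem _ (hmem (e m))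
        (tailSubgroup_antitone (Nat.le_succ m) h)) (hmem (-f m))
      convert this using 1
      simp only [orderedProd]
      group
    have h2 := ih (by omega) h1
    have h3 : orderedProd a e m = orderedProd a f m :=
      orderedProd_congr fun i hi => by rw [h2 i hi]
    have h4 : a m ^ (-e m + f m) ∈ tailSubgroup a (m + 1) := by
      convert h using 1
      simp only [orderedProd, h3, zpow_add, zpow_neg]
      group
    have h5 := ha.zpow_mem m (by omega) _ h4
    intro i hi
    rcases Nat.lt_succ_iff_lt_or_eq.mp hi with h | rfl
    · exact h2 i h
    · omega

/-- The first `m` coordinates depend only on the class modulo `U_m`, which allows arguments with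
truncated normal forms. -/
theorem coord_eq (ha : IsConsistentSequence a n t) {e : ℕ → ℤ} {g : G} {m : ℕ} (hm : m ≤ n)
    (h : (orderedProd a e m)⁻¹ * g ∈ tailSubgroup a m) {i : ℕ} (hi : i < m) :
    coord a n g i = e i := by
  refine (ha.exponents_unique hm ?_ i hi).symm
  have h1 := inv_orderedProd_mul_mem (a := a) (coord a n g) hm
  rw [ha.orderedProd_coord] at h1
  have := Subgroup.mul_mem _ h (Subgroup.inv_mem _ h1)
  convert this using 1
  group

theorem coord_orderedProd (ha : IsConsistentSequence a n t) (e : ℕ → ℤ) {i : ℕ} (hi : i < n) :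
    coord a n (orderedProd a e n) i = e i :=
  ha.coord_eq le_rfl (by simp) hi

theorem coord_congr (ha : IsConsistentSequence a n t) {g h : G} {m : ℕ} (hm : m ≤ n)
    (hgh : g⁻¹ * h ∈ tailSubgroup a m) {i : ℕ} (hi : i < m) :
    coord a n h i = coord a n g i := by
  refine ha.coord_eq hm ?_ hi
  have h1 := inv_orderedProd_mul_mem (a := a) (coord a n g) hm
  rw [ha.orderedProd_coord] at h1
  have := Subgroup.mul_mem _ h1 hgh
  convert this using 1
  group

theorem coord_zpow (ha : IsConsistentSequence a n t) {k : ℕ} (hk : k < n) (s : ℤ) :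
    coord a n (a k ^ s) k = s := by
  have h : (orderedProd a (Pi.single k s) (k + 1))⁻¹ * a k ^ s ∈ tailSubgroup a (k + 1) := by
    rw [orderedProd, orderedProd_eq_one fun i hi => Pi.single_eq_of_ne hi.ne _]
    simp
  rw [ha.coord_eq (by omega) h (by omega), Pi.single_eq_same]

theorem coord_of_mem_tail (ha : IsConsistentSequence a n t) {g : G} {j : ℕ}
    (hg : g ∈ tailSubgroup a j) {i : ℕ} (hi : i < j) : coord a n g i = 0 := by
  rcases lt_or_ge i n with h | h
  · refine ha.coord_eq (e := 0) (m := i + 1) (by omega) ?_ (Nat.lt_succ_self i)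
    rw [orderedProd_eq_one (e := 0) fun _ _ => rfl, inv_one, one_mul]
    exact tailSubgroup_antitone hi hg
  · exact ha.coord_of_le g h

end IsConsistentSequence

end Sequences

end HallPoly

namespace HallPoly

/-! ### Difference equations and Bernoulli polynomials -/

section Bernoulli

variable {R : Type*} [CommRing R] [Algebra ℚ R]

/-- The polynomial solution `f` of `f(x + 1) = f(x) + x ^ l`, `f(0) = 0`. -/
noncomputable def powerSum (l : ℕ) : Polynomial ℚ :=
  ∑ k ∈ Finset.range (l + 1),
    Polynomial.monomial (l + 1 - k) (bernoulli k * ((l + 1).choose k : ℚ) / ((l + 1 : ℕ) : ℚ))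

/-- Reduces the difference equation to `B_{l+1}(x + 1) - B_{l+1}(x) = (l + 1) x ^ l`. -/
theorem powerSum_eq (l : ℕ) :
    powerSum l = Polynomial.C ((l + 1 : ℚ)⁻¹) *
      (Polynomial.bernoulli (l + 1) - Polynomial.C (bernoulli (l + 1))) := by
  rw [Polynomial.bernoulli, Finset.sum_range_succ, powerSum, Nat.sub_self, Nat.choose_self,
    Nat.cast_one, mul_one, Polynomial.monomial_zero_left, add_sub_cancel_right, Finset.mul_sum]
  refine Finset.sum_congr rfl fun k _ => ?_
  rw [Polynomial.C_mul_monomial]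
  congr 1
  push_cast
  ring

theorem powerSum_comp (l : ℕ) :
    (powerSum l).comp (Polynomial.X + 1) = powerSum l + Polynomial.X ^ l := by
  have h := Polynomial.bernoulli_comp_one_add_X (l + 1)
  rw [add_comm (1 : Polynomial ℚ)] at h
  simp only [powerSum_eq, Polynomial.mul_comp, Polynomial.sub_comp, Polynomial.C_comp, h]
  have h0 : Polynomial.C ((l + 1 : ℚ)⁻¹) * ((l + 1 : ℕ) : Polynomial ℚ) = 1 := by
    rw [← Polynomial.C_eq_natCast, ← Polynomial.C_mul]
    rw [← Polynomial.C_1]; congr 1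
    push_cast
    exact inv_mul_cancel₀ (by positivity)
  simp only [nsmul_eq_mul, Nat.add_sub_cancel]
  linear_combination (Polynomial.X ^ l) * h0

/-- By linearity the solution is assembled from those for the monomials of `g`. The two double sums
correspond under `l = m + k - 1`. -/
theorem bernoulliSolution_eq (f₀ : R) (g : Polynomial R) :
    bernoulliSolution f₀ g = Polynomial.C f₀ + ∑ l ∈ Finset.range (g.natDegree + 1),
      Polynomial.C (g.coeff l) * (powerSum l).map (algebraMap ℚ R) := by
  rw [bernoulliSolution]
  congr 1
  simp only [powerSum, Polynomial.map_sum, Polynomial.map_monomial, Finset.mul_sum,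
    Polynomial.C_mul_monomial, map_sum, Finset.sum_mul, Polynomial.C_mul_X_pow_eq_monomial]
  rw [Finset.sum_sigma', Finset.sum_sigma']
  refine Finset.sum_bij' (fun p _ => ⟨p.1 + p.2 - 1, p.2⟩) (fun p _ => ⟨p.1 + 1 - p.2, p.2⟩)
    ?_ ?_ ?_ ?_ ?_
  · rintro ⟨m, k⟩ h
    simp only [Finset.mem_sigma, Finset.mem_Icc, Finset.mem_range] at h ⊢
    omega
  · rintro ⟨l, k⟩ h
    simp only [Finset.mem_sigma, Finset.mem_Icc, Finset.mem_range] at h ⊢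
    omega
  · rintro ⟨m, k⟩ h
    simp only [Finset.mem_sigma, Finset.mem_Icc, Finset.mem_range] at h
    simp only [Sigma.mk.injEq, heq_eq_eq, and_true]
    omega
  · rintro ⟨l, k⟩ h
    simp only [Finset.mem_sigma, Finset.mem_range] at h
    simp only [Sigma.mk.injEq, heq_eq_eq, and_true]
    omega
  · rintro ⟨m, k⟩ h
    simp only [Finset.mem_sigma, Finset.mem_Icc, Finset.mem_range] at h
    have h1 : m + k - 1 + 1 = m + k := by omega
    have h2 : m + k - k = m := by omega
    simp only [h1, h2, Algebra.smul_def, mul_comm]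

theorem bernoulliSolution_comp (f₀ : R) (g : Polynomial R) :
    (bernoulliSolution f₀ g).comp (Polynomial.X + 1) = bernoulliSolution f₀ g + g := by
  have h : ∀ l, ((powerSum l).map (algebraMap ℚ R)).comp (Polynomial.X + 1) =
      (powerSum l).map (algebraMap ℚ R) + Polynomial.X ^ l := by
    intro l
    have := congrArg (Polynomial.map (algebraMap ℚ R)) (powerSum_comp l)
    simpa [Polynomial.map_comp] using this
  rw [← Polynomial.coe_compRingHom_apply, bernoulliSolution_eq, map_add, map_sum]
  simp only [map_mul, Polynomial.coe_compRingHom_apply, Polynomial.C_comp, h, mul_add,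
    Finset.sum_add_distrib]
  rw [← g.as_sum_range_C_mul_X_pow, add_assoc]

theorem bernoulliSolution_eval_zero (f₀ : R) (g : Polynomial R) :
    (bernoulliSolution f₀ g).eval 0 = f₀ := by
  rw [bernoulliSolution, Polynomial.eval_add, Polynomial.eval_C, Polynomial.eval_finsetSum,
    Finset.sum_eq_zero, add_zero]
  intro m hm
  have : m ≠ 0 := by have := Finset.mem_Icc.mp hm; omega
  simp [this]

end Bernoulli

/-- Functions on `ℤ` with the same differences and the same value at `0` are equal. -/
theorem eq_of_differences {φ ψ d : ℤ → ℚ} (h0 : φ 0 = ψ 0)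
    (hφ : ∀ v, φ (v + 1) = φ v + d v) (hψ : ∀ v, ψ (v + 1) = ψ v + d v) (v : ℤ) :
    φ v = ψ v := by
  induction v using Int.induction_on with
  | zero => exact h0
  | succ i ih => rw [hφ, hψ, ih]
  | pred i ih =>
    have h1 := hφ (-i - 1)
    have h2 := hψ (-i - 1)
    rw [sub_add_cancel] at h1 h2
    linarith

/-! ### Adjoining an integer variable to an algebra of functions -/

section Extension

variable {X : Type}

/-- Evaluation at a point, on an algebra of functions. -/
def evalPoint (A : Subalgebra ℚ (X → ℚ)) (x : X) : A →+* ℚ :=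
  (Pi.evalRingHom (fun _ => ℚ) x).comp A.val.toRingHom

@[simp]
theorem evalPoint_apply (A : Subalgebra ℚ (X → ℚ)) (x : X) (f : A) :
    evalPoint A x f = f.1 x := rfl

/-- The functions `(x, v) ↦ c₀(x) + c₁(x) v + ⋯ + c_l(x) v ^ l` on `X × ℤ` with `c_i ∈ A`. -/
noncomputable def polyExtension (A : Subalgebra ℚ (X → ℚ)) : Subalgebra ℚ (X × ℤ → ℚ) where
  carrier := {F | ∃ P : Polynomial A, ∀ x (v : ℤ), F (x, v) = P.eval₂ (evalPoint A x) (v : ℚ)}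
  mul_mem' := by
    rintro F H ⟨P, hP⟩ ⟨Q, hQ⟩
    exact ⟨P * Q, fun x v => by simp [hP, hQ, Polynomial.eval₂_mul]⟩
  add_mem' := by
    rintro F H ⟨P, hP⟩ ⟨Q, hQ⟩
    exact ⟨P + Q, fun x v => by simp [hP, hQ, Polynomial.eval₂_add]⟩
  algebraMap_mem' r := ⟨Polynomial.C (algebraMap ℚ A r), fun x v => by
    rw [Polynomial.eval₂_C]; rfl⟩

variable {A : Subalgebra ℚ (X → ℚ)}

theorem comp_fst_mem_polyExtension {f : X → ℚ} (hf : f ∈ A) :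
    (fun p : X × ℤ => f p.1) ∈ polyExtension A :=
  ⟨Polynomial.C ⟨f, hf⟩, fun x v => by simp⟩

theorem snd_mem_polyExtension : (fun p : X × ℤ => (p.2 : ℚ)) ∈ polyExtension A :=
  ⟨Polynomial.X, fun x v => by simp⟩

theorem shift_mem_polyExtension {F : X × ℤ → ℚ} (hF : F ∈ polyExtension A) :
    (fun p => F (p.1, p.2 + 1)) ∈ polyExtension A := by
  obtain ⟨P, hP⟩ := hF
  refine ⟨P.comp (Polynomial.X + 1), fun x v => ?_⟩
  simp [hP, Polynomial.eval₂_comp]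

/-- An integer-valued `m ∈ A` may replace the new variable: evaluate the polynomial over `A` at `m`
itself. -/
theorem substitute_mem {F : X × ℤ → ℚ} (hF : F ∈ polyExtension A) {m : X → ℤ}
    (hm : (fun x => (m x : ℚ)) ∈ A) : (fun x => F (x, m x)) ∈ A := by
  obtain ⟨P, hP⟩ := hF
  have : (fun x => F (x, m x)) = (P.eval ⟨_, hm⟩ : A).1 := by
    funext x
    rw [hP, ← evalPoint_apply, Polynomial.eval, Polynomial.hom_eval₂]
    simp
  rw [this]
  exact Subtype.prop _

/-- A function with polynomial differences is polynomial. -/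
theorem mem_polyExtension_of_differences {F : X × ℤ → ℚ}
    (h0 : (fun x => F (x, 0)) ∈ A)
    (hd : (fun p => F (p.1, p.2 + 1) - F p) ∈ polyExtension A) : F ∈ polyExtension A := by
  obtain ⟨P, hP⟩ := hd
  refine ⟨bernoulliSolution ⟨_, h0⟩ P, fun x v => ?_⟩
  refine eq_of_differences (φ := fun v => F (x, v))
    (ψ := fun v => (bernoulliSolution ⟨_, h0⟩ P).eval₂ (evalPoint A x) (v : ℚ))
    (d := fun v => P.eval₂ (evalPoint A x) (v : ℚ)) ?_ (fun v => ?_) (fun v => ?_) v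
  · have h := congrArg (evalPoint A x) (bernoulliSolution_eval_zero ⟨_, h0⟩ P)
    rw [Polynomial.eval, Polynomial.hom_eval₂] at h
    simpa using h.symm
  · rw [← hP]; simp
  · have h := congrArg (Polynomial.eval₂ (evalPoint A x) (v : ℚ))
      (bernoulliSolution_comp ⟨_, h0⟩ P)
    simpa [Polynomial.eval₂_comp, Polynomial.eval₂_add] using h

end Extension

end HallPoly

/-! ### Hall's theorem: polynomial coordinates of products and powers -/

namespace HallPoly

/-- A family of groups with consistent sequences of generators over a set of points, the
parameters of whose relations lie in an algebra of functions on the points. -/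
structure PolyData (n : ℕ) where
  Point : Type
  alg : Subalgebra ℚ (Point → ℚ)
  Grp : Point → Type
  group : ∀ x, Group (Grp x)
  seq : ∀ x, ℕ → Grp x
  param : Point → ℕ → ℕ → ℕ → ℤ
  consistent : ∀ x, IsConsistentSequence (seq x) n (param x)
  param_mem : ∀ i j k, (fun x => (param x i j k : ℚ)) ∈ alg

attribute [instance] PolyData.group

namespace PolyData

variable {n : ℕ}

/-- The base change of a family to the points `(x, v)` with `v ∈ ℤ`. -/
noncomputable def ext (D : PolyData n) : PolyData n where
  Point := D.Point × ℤ
  alg := polyExtension D.alg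
  Grp p := D.Grp p.1
  group p := D.group p.1
  seq p := D.seq p.1
  param p := D.param p.1
  consistent p := D.consistent p.1
  param_mem i j k := comp_fst_mem_polyExtension (D.param_mem i j k)

variable (D : PolyData n)

/-- The families of elements of the `j`-th tail subgroups with polynomial exponents. -/
structure IsPoly (j : ℕ) (g : ∀ x, D.Grp x) : Prop where
  mem : ∀ x, g x ∈ tailSubgroup (D.seq x) j
  coord_mem : ∀ k, (fun x => (coord (D.seq x) n (g x) k : ℚ)) ∈ D.alg

variable {D} {j : ℕ}

theorem intCast_mem (z : ℤ) : (fun _ => (z : ℚ)) ∈ D.alg :=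
  D.alg.algebraMap_mem (z : ℚ)

theorem IsPoly.mono {i : ℕ} {g : ∀ x, D.Grp x} (hg : D.IsPoly j g) (h : i ≤ j) : D.IsPoly i g :=
  ⟨fun x => tailSubgroup_antitone h (hg.mem x), hg.coord_mem⟩

theorem isPoly_of_mem {g : ∀ x, D.Grp x} (hg : ∀ x, g x ∈ tailSubgroup (D.seq x) j)
    (h : ∀ k, j ≤ k → k < n → (fun x => (coord (D.seq x) n (g x) k : ℚ)) ∈ D.alg) :
    D.IsPoly j g := by
  refine ⟨hg, fun k => ?_⟩
  rcases lt_or_ge k j with hk | hk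
  · simp only [(D.consistent _).coord_of_mem_tail (hg _) hk]
    exact intCast_mem 0
  rcases lt_or_ge k n with hn | hn
  · exact h k hk hn
  · simp only [(D.consistent _).coord_of_le _ hn]
    exact intCast_mem 0

theorem isPoly_orderedProd {e : D.Point → ℕ → ℤ} (h : ∀ x, ∀ i < j, e x i = 0)
    (he : ∀ k, j ≤ k → k < n → (fun x => (e x k : ℚ)) ∈ D.alg) :
    D.IsPoly j fun x => orderedProd (D.seq x) (e x) n := by
  refine isPoly_of_mem (fun x => orderedProd_mem_tail (h x)) fun k hk hn => ?_
  simp only [(D.consistent _).coord_orderedProd _ hn]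
  exact he k hk hn

theorem isPoly_zpow (m : D.Point → ℤ) (hm : (fun x => (m x : ℚ)) ∈ D.alg) :
    D.IsPoly j fun x => D.seq x j ^ m x := by
  rcases lt_or_ge j n with hj | hj
  · have h := isPoly_orderedProd (D := D) (j := j) (e := fun x => Pi.single j (m x))
      (fun x i hi => Pi.single_eq_of_ne hi.ne _) fun k hk hn => by
        rcases eq_or_ne k j with rfl | h
        · simpa using hm
        · simpa [Pi.single_eq_of_ne h] using intCast_mem 0
    simpa only [orderedProd_single _ hj] using h
  · refine isPoly_of_mem (fun x => ?_) fun k hk hn => by omega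
    exact Subgroup.zpow_mem _ (mem_tailSubgroup le_rfl) _

/-- Polynomial families in the `j`-th tail subgroups are closed under products and powers. -/
def ClosedAt (n j : ℕ) : Prop :=
  ∀ D : PolyData n,
    (∀ g h, D.IsPoly j g → D.IsPoly j h → D.IsPoly j fun x => g x * h x) ∧
    ∀ (g) (m : D.Point → ℤ), D.IsPoly j g → (fun x => (m x : ℚ)) ∈ D.alg →
      D.IsPoly j fun x => g x ^ m x

theorem closedAt_of_le (h : n ≤ j) : ClosedAt n j := fun _ =>
  ⟨fun _ _ hg hh => isPoly_of_mem (fun x => Subgroup.mul_mem _ (hg.mem x) (hh.mem x))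
    fun _ _ _ => by omega,
   fun _ _ hg _ => isPoly_of_mem (fun x => Subgroup.zpow_mem _ (hg.mem x) _)
    fun _ _ _ => by omega⟩

/-- A family with `c(x, v + 1) = b₁(x) c(x, v) b₂(x)` is polynomial if `c(x, 0)` is and if
`g ↦ b₁ g b₂` preserves polynomial families. -/
theorem isPoly_of_recursion {b₁ b₂ : ∀ x, D.Grp x} {c : ∀ p : D.Point × ℤ, D.Grp p.1}
    (hmem : ∀ p, c p ∈ tailSubgroup (D.seq p.1) j)
    (h0 : D.IsPoly j fun x => c (x, 0))
    (hc : ∀ (x) (v : ℤ), c (x, v + 1) = b₁ x * c (x, v) * b₂ x)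
    (hcl : ∀ p q : (∀ y : D.Point × ℤ, D.Grp y.1), D.ext.IsPoly j p → D.ext.IsPoly j q →
      D.ext.IsPoly j fun y : D.Point × ℤ => (q y)⁻¹ * (b₁ y.1 * p y * b₂ y.1)) :
    D.ext.IsPoly j c := by
  suffices h : ∀ k, (fun y : D.Point × ℤ => (coord (D.seq y.1) n (c y) k : ℚ)) ∈
      polyExtension D.alg from ⟨hmem, h⟩
  intro k
  induction k using Nat.strong_induction_on with
  | _ k ih =>
  rcases lt_or_ge k n with hk | hk
  swap
  · simp only [(D.consistent _).coord_of_le _ hk]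
    exact intCast_mem (D := D.ext) 0
  refine mem_polyExtension_of_differences (h0.coord_mem k) ?_
  -- `p` keeps the coordinates below `k`, polynomial by induction, and `q` is its shift by one in
  -- `v`.
  let e : D.Point × ℤ → ℕ → ℤ := fun y i => if i < k then coord (D.seq y.1) n (c y) i else 0
  let p : ∀ y : D.Point × ℤ, D.Grp y.1 := fun y => orderedProd (D.seq y.1) (e y) n
  let q : ∀ y : D.Point × ℤ, D.Grp y.1 := fun y => p (y.1, y.2 + 1)
  have hez : ∀ y, ∀ i < j, e y i = 0 := fun y i hi => by
    simp only [e]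
    split_ifs
    · exact (D.consistent y.1).coord_of_mem_tail (hmem y) hi
    · rfl
  have he : ∀ i, (fun y => (e y i : ℚ)) ∈ polyExtension D.alg := fun i => by
    by_cases hi : i < k
    · simpa only [e, hi, if_true] using ih i hi
    · simp only [e, hi, if_false]
      exact intCast_mem (D := D.ext) 0
  have hp : D.ext.IsPoly j p := isPoly_orderedProd hez fun i _ _ => he i
  have hq : D.ext.IsPoly j q := isPoly_orderedProd (D := D.ext)
    (e := fun y => e (y.1, y.2 + 1)) (fun y => hez _) fun i _ _ => shift_mem_polyExtension (he i)
  have hd := (hcl p q hp hq).coord_mem k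
  have happrox : ∀ y, (p y * D.seq y.1 k ^ coord (D.seq y.1) n (c y) k)⁻¹ * c y ∈
      tailSubgroup (D.seq y.1) (k + 1) := by
    intro y
    have h := inv_orderedProd_mul_mem (a := D.seq y.1) (coord (D.seq y.1) n (c y))
      (Nat.succ_le_of_lt hk)
    rw [(D.consistent y.1).orderedProd_coord] at h
    rw [orderedProd] at h
    simp only [p, e]
    rwa [orderedProd_truncate _ hk.le]
  -- Modulo `U_{k+1}`, `c(v) ≡ p a_k ^ s` and `c(v + 1) ≡ q a_k ^ s'`. Since `a_k ^ s` commutes with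
  -- `b₂` there, the recursion gives `q⁻¹ b₁ p b₂ ≡ a_k ^ (s' - s)`: the increment is a coordinate
  -- already known to be polynomial.
  refine (congrArg (· ∈ polyExtension D.alg) (funext ?_)).mpr hd
  rintro ⟨x, v⟩
  have ha := D.consistent x
  have hN := ha.tail_normal (k + 1)
  have h1 := happrox (x, v)
  have h2 := happrox (x, v + 1)
  rw [hc] at h2
  set s := coord (D.seq x) n (c (x, v)) k
  set s' := coord (D.seq x) n (b₁ x * c (x, v) * b₂ x) k with hs'
  have h3 := ha.tail_central (b₂ x)
    (Subgroup.zpow_mem _ (mem_tailSubgroup (a := D.seq x) le_rfl) s : _ ∈ tailSubgroup _ k)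
  have h4 : (D.seq x k ^ (s' - s))⁻¹ * ((q (x, v))⁻¹ * (b₁ x * p (x, v) * b₂ x)) ∈
      tailSubgroup (D.seq x) (k + 1) := by
    have h5 := hN.conj_mem _ (Subgroup.inv_mem _ h1) (b₂ x)⁻¹
    have h6 := hN.conj_mem _ (Subgroup.mul_mem _ (Subgroup.mul_mem _ h2 h5) h3)
      (D.seq x k ^ s)
    convert h6 using 1
    change _ = D.seq x k ^ s * ((q (x, v) * D.seq x k ^ s')⁻¹ * (b₁ x * c (x, v) * b₂ x) *
      ((b₂ x)⁻¹ * ((p (x, v) * D.seq x k ^ s)⁻¹ * c (x, v))⁻¹ * (b₂ x)⁻¹⁻¹) *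
      ((b₂ x)⁻¹ * (D.seq x k ^ s)⁻¹ * b₂ x * D.seq x k ^ s)) * (D.seq x k ^ s)⁻¹
    group
  have h7 := ha.coord_congr hk h4 (Nat.lt_succ_self k)
  rw [ha.coord_zpow hk] at h7
  change ((coord (D.seq x) n (c (x, v + 1)) k : ℤ) : ℚ) - s =
    (coord (D.seq x) n ((q (x, v))⁻¹ * (b₁ x * p (x, v) * b₂ x)) k : ℤ)
  rw [h7, hc, Int.cast_sub]

theorem IsPoly.substitute {c : ∀ p : D.Point × ℤ, D.Grp p.1} (hc : D.ext.IsPoly j c) {m : D.Point → ℤ}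
    (hm : (fun x => (m x : ℚ)) ∈ D.alg) : D.IsPoly j fun x => c (x, m x) :=
  ⟨fun x => hc.mem (x, m x), fun k => substitute_mem (hc.coord_mem k) hm⟩

theorem IsPoly.comp_fst {g : ∀ x, D.Grp x} (hg : D.IsPoly j g) :
    D.ext.IsPoly j fun p => g p.1 :=
  ⟨fun p => hg.mem p.1, fun k => comp_fst_mem_polyExtension (hg.coord_mem k)⟩

theorem neg_mem {m : D.Point → ℤ} (hm : (fun x => (m x : ℚ)) ∈ D.alg) :
    (fun x => ((-m x : ℤ) : ℚ)) ∈ D.alg := by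
  simp only [Int.cast_neg]
  exact D.alg.neg_mem hm

theorem add_mem {m k : D.Point → ℤ} (hm : (fun x => (m x : ℚ)) ∈ D.alg)
    (hk : (fun x => (k x : ℚ)) ∈ D.alg) : (fun x => ((m x + k x : ℤ) : ℚ)) ∈ D.alg := by
  simp only [Int.cast_add]
  exact D.alg.add_mem hm hk

theorem isPoly_one : D.IsPoly j fun _ => 1 := by
  have h := isPoly_orderedProd (D := D) (j := j) (e := fun _ _ => 0) (fun _ _ _ => rfl)
    fun _ _ _ => intCast_mem 0
  simpa only [orderedProd_eq_one fun _ _ => rfl] using h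

theorem isPoly_zpow_mul (hj : j < n) {m : D.Point → ℤ} (hm : (fun x => (m x : ℚ)) ∈ D.alg)
    {u : ∀ x, D.Grp x} (hu : D.IsPoly (j + 1) u) :
    D.IsPoly j fun x => D.seq x j ^ m x * u x := by
  have hz : ∀ x, ∀ i ≤ j, coord (D.seq x) n (u x) i = 0 := fun x i hi =>
    (D.consistent x).coord_of_mem_tail (hu.mem x) (Nat.lt_succ_of_le hi)
  let e : D.Point → ℕ → ℤ := fun x => Function.update (coord (D.seq x) n (u x)) j (m x)
  have hez : ∀ x, ∀ i < j, e x i = 0 := fun x i hi => by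
    simp only [e, Function.update_of_ne hi.ne, hz x i hi.le]
  have he := isPoly_orderedProd (D := D) (e := e) hez fun k _ _ => by
    rcases eq_or_ne k j with rfl | h
    · simpa only [e, Function.update_self] using hm
    · simpa only [e, Function.update_of_ne h] using hu.coord_mem k
  convert he using 2 with x
  rw [orderedProd_split (hez x) hj]
  congr 1
  · simp only [e, Function.update_self]
  · conv_lhs => rw [← (D.consistent x).orderedProd_coord (u x)]
    congr 1
    funext i
    split_ifs with h
    · exact hz x i h
    · exact (Function.update_of_ne (by omega) _ _).symm

theorem IsPoly.exists_zpow_mul (hj : j < n) {g : ∀ x, D.Grp x} (hg : D.IsPoly j g) :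
    ∃ (m : D.Point → ℤ) (u : ∀ x, D.Grp x), (fun x => (m x : ℚ)) ∈ D.alg ∧
      D.IsPoly (j + 1) u ∧ g = fun x => D.seq x j ^ m x * u x := by
  refine ⟨_, _, hg.coord_mem j, isPoly_orderedProd (D := D) (j := j + 1)
    (e := fun x i => if i ≤ j then 0 else coord (D.seq x) n (g x) i)
    (fun x i hi => if_pos (Nat.le_of_lt_succ hi)) fun k hk _ => ?_, ?_⟩
  · simpa only [if_neg (Nat.not_le.mpr hk)] using hg.coord_mem k
  · funext x
    rw [← orderedProd_split (fun i hi => (D.consistent x).coord_of_mem_tail (hg.mem x) hi) hj,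
      (D.consistent x).orderedProd_coord]

theorem isPoly_orderedProd_family (hcl : ClosedAt n j) {f : ∀ x, ℕ → D.Grp x}
    (hf : ∀ k, D.IsPoly j fun x => f x k) {e : D.Point → ℕ → ℤ}
    (he : ∀ k, (fun x => (e x k : ℚ)) ∈ D.alg) (m : ℕ) :
    D.IsPoly j fun x => orderedProd (f x) (e x) m := by
  induction m with
  | zero => exact isPoly_one
  | succ m ih => exact (hcl D).1 _ _ ih ((hcl D).2 _ _ (hf m) (he m))

theorem isPoly_inv (hcl : ClosedAt n j) {g : ∀ x, D.Grp x} (hg : D.IsPoly j g) :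
    D.IsPoly j fun x => (g x)⁻¹ := by
  simpa using (hcl D).2 _ (fun _ => -1) hg (intCast_mem _)

theorem isPoly_seq (j : ℕ) : D.IsPoly j fun x => D.seq x j := by
  simpa using isPoly_zpow (D := D) (j := j) (fun _ => 1) (intCast_mem _)

/-- Conjugation by `a_j` is a homomorphism, so it acts on the normal form of `u` factor by factor.
The relations give the conjugate of each `a_k`, `k > j`, as a polynomial family in `U_{j+1}`. -/
theorem isPoly_conj (hcl : ClosedAt n (j + 1)) {u : ∀ x, D.Grp x} (hu : D.IsPoly (j + 1) u) :
    D.IsPoly (j + 1) fun x => (D.seq x j)⁻¹ * u x * D.seq x j := by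
  -- The factors with `k ≤ j` have exponent `0`; the base `1` keeps them inside `U_{j+1}`.
  have h : ∀ x, (D.seq x j)⁻¹ * u x * D.seq x j =
      orderedProd (fun k => if k ≤ j then 1 else (D.seq x j)⁻¹ * D.seq x k * D.seq x j)
        (coord (D.seq x) n (u x)) n := by
    intro x
    have h1 := map_orderedProd (a := D.seq x) (MulAut.conj (D.seq x j)⁻¹).toMonoidHom
      (coord (D.seq x) n (u x)) n
    rw [(D.consistent x).orderedProd_coord] at h1
    simp only [MulEquiv.toMonoidHom_eq_coe, MonoidHom.coe_coe, MulAut.conj_apply, inv_inv] at h1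
    rw [h1]
    refine orderedProd_congr fun i _ => ?_
    split_ifs with hi
    · rw [(D.consistent x).coord_of_mem_tail (hu.mem x) (Nat.lt_succ_of_le hi), zpow_zero,
        zpow_zero]
    · rfl
  simp only [h]
  refine isPoly_orderedProd_family hcl (fun k => ?_) hu.coord_mem n
  split_ifs with hk
  · exact isPoly_one
  push Not at hk
  rcases lt_or_ge k n with hn | hn
  · have h2 : ∀ x, (D.seq x j)⁻¹ * D.seq x k * D.seq x j =
        D.seq x k * orderedProd (D.seq x) (D.param x j k) n := by
      intro x
      rw [mul_assoc, (D.consistent x).rel j k hk hn]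
      group
    simp only [h2]
    exact (hcl D).1 _ _ ((isPoly_seq k).mono hk) (isPoly_orderedProd
      (fun x i hi => (D.consistent x).param_eq_zero j k i (by omega))
      fun i _ _ => D.param_mem j k i)
  · have h2 : ∀ x, (D.seq x j)⁻¹ * D.seq x k * D.seq x j = 1 := by
      intro x
      rw [(D.consistent x).eq_one k hn]
      group
    simp only [h2]
    exact isPoly_one

theorem isPoly_conj_zpow (hcl : ClosedAt n (j + 1)) {u : ∀ x, D.Grp x}
    (hu : D.IsPoly (j + 1) u) {m : D.Point → ℤ} (hm : (fun x => (m x : ℚ)) ∈ D.alg) :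
    D.IsPoly (j + 1) fun x => (D.seq x j ^ m x)⁻¹ * u x * D.seq x j ^ m x := by
  let c : ∀ p : D.Point × ℤ, D.Grp p.1 := fun p =>
    (D.seq p.1 j ^ p.2)⁻¹ * u p.1 * D.seq p.1 j ^ p.2
  suffices h : D.ext.IsPoly (j + 1) c from h.substitute hm
  refine isPoly_of_recursion (D := D) (b₁ := fun x => (D.seq x j)⁻¹) (b₂ := fun x => D.seq x j)
    (fun p => ?_) ?_ (fun x v => ?_) fun p q hp hq => ?_
  · have := ((D.consistent p.1).tail_normal (j + 1)).conj_mem _ (hu.mem p.1)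
      (D.seq p.1 j ^ p.2)⁻¹
    rwa [inv_inv] at this
  · simpa [c] using hu
  · simp only [c]
    group
  · exact (hcl D.ext).1 _ _ (isPoly_inv hcl hq) (isPoly_conj (D := D.ext) hcl hp)

/-- Products and inverses follow from `a ^ r u a ^ s w = a ^ (r + s) (a ^ (-s) u a ^ s) w` and its
analogue for inverses. Powers then follow by the recursion in the exponent, which uses products and
inverses over `D.ext`; hence `ClosedAt` quantifies over all families. -/
theorem closedAt_of_succ (hj : j < n) (hcl : ClosedAt n (j + 1)) : ClosedAt n j := by
  have hmul : ∀ (D : PolyData n) (g h), D.IsPoly j g → D.IsPoly j h →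
      D.IsPoly j fun x => g x * h x := by
    intro D g h hg hh
    obtain ⟨r, u, hr, hu, rfl⟩ := hg.exists_zpow_mul hj
    obtain ⟨s, w, hs, hw, rfl⟩ := hh.exists_zpow_mul hj
    have := isPoly_zpow_mul hj (m := fun x => r x + s x) (add_mem hr hs)
      ((hcl D).1 _ _ (isPoly_conj_zpow hcl hu hs) hw)
    convert this using 2 with x
    group
  have hinv : ∀ (D : PolyData n) (g), D.IsPoly j g → D.IsPoly j fun x => (g x)⁻¹ := by
    intro D g hg
    obtain ⟨r, u, hr, hu, rfl⟩ := hg.exists_zpow_mul hj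
    have := isPoly_zpow_mul hj (neg_mem hr)
      (isPoly_conj_zpow hcl (isPoly_inv hcl hu) (neg_mem hr))
    convert this using 2 with x
    group
  refine fun D => ⟨hmul D, fun g m hg hm => ?_⟩
  let c : ∀ p : D.Point × ℤ, D.Grp p.1 := fun p => g p.1 ^ p.2
  suffices h : D.ext.IsPoly j c from h.substitute hm
  refine isPoly_of_recursion (D := D) (b₁ := fun x => 1) (b₂ := g)
    (fun p => Subgroup.zpow_mem _ (hg.mem p.1) _) ?_ (fun x v => ?_) fun p q hp hq => ?_
  · simpa [c] using isPoly_one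
  · simp only [c, one_mul, zpow_add_one]
  · refine hmul D.ext _ _ (hinv D.ext _ hq) ?_
    simp only [one_mul]
    exact hmul D.ext _ _ hp hg.comp_fst

theorem closedAt (n j : ℕ) : ClosedAt n j := by
  rcases le_total n j with h | h
  · exact closedAt_of_le h
  · induction h using Nat.decreasingInduction with
    | self => exact closedAt_of_le le_rfl
    | of_succ k hk ih => exact closedAt_of_succ hk ih

end PolyData

end HallPoly

namespace HallPoly

/-! ### The groups `G(t)` and consistency -/

section Presentation

variable {n : ℕ}

/-- The generators of `G(t)`, continued by `1`. -/
def genSeq (t : ParamIndex n → ℤ) (k : ℕ) : NilpGroup t :=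
  if h : k < n then gen t ⟨k, h⟩ else 1

/-- The parameters, continued by `0`. -/
def paramSeq (t : ParamIndex n → ℤ) (i j k : ℕ) : ℤ :=
  if h : i < j ∧ j < k ∧ k < n then
    t ⟨(⟨i, by omega⟩, ⟨j, by omega⟩, ⟨k, h.2.2⟩), h.1, h.2.1⟩ else 0

/-- An exponent vector with indices larger than `j`, continued by `0`. -/
def extendExponents (j : Fin n) (r : {k : Fin n // j < k} → ℤ) (k : ℕ) : ℤ :=
  if h : k < n then if h' : j < ⟨k, h⟩ then r ⟨⟨k, h⟩, h'⟩ else 0 else 0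

theorem list_prod_ofFn {G : Type*} [Group G] (a : ℕ → G) (e : ℕ → ℤ) (m : ℕ) :
    (List.ofFn fun k : Fin m => a k ^ e k).prod = orderedProd a e m := by
  induction m with
  | zero => simp [orderedProd]
  | succ m ih =>
    rw [List.ofFn_succ', List.concat_eq_append, List.prod_append, orderedProd, ← ih]
    simp

theorem tailProd_eq {G : Type*} [Group G] {b : Fin n → G} {a : ℕ → G} (h : ∀ k, a k.1 = b k)
    (j : Fin n) (r : {k : Fin n // j < k} → ℤ) :
    tailProd b j r = orderedProd a (extendExponents j r) n := by
  rw [← list_prod_ofFn, tailProd]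
  congr 2
  funext k
  simp only [extendExponents, k.2, dif_pos, h]
  split_ifs <;> simp

theorem map_tailProd {G H : Type*} [Group G] [Group H] (φ : G →* H) (b : Fin n → G) (j : Fin n)
    (r : {k : Fin n // j < k} → ℤ) :
    φ (tailProd b j r) = tailProd (fun k => φ (b k)) j r := by
  rw [tailProd, tailProd, map_list_prod, List.map_ofFn]
  congr 2
  funext k
  simp only [Function.comp]
  split_ifs <;> simp

theorem genSeq_val (t : ParamIndex n → ℤ) (k : Fin n) : genSeq t k.1 = gen t k := by
  simp [genSeq]

theorem gen_rel (t : ParamIndex n → ℤ) {i j : Fin n} (hij : i < j) :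
    gen t j * gen t i = gen t i * gen t j *
      tailProd (gen t) j fun k => t ⟨(i, j, k.1), hij, k.2⟩ := by
  have h : PresentedGroup.mk (relators t) _ = 1 :=
    PresentedGroup.one_of_mem (rels := relators t) ⟨i, j, hij, rfl⟩
  rw [map_mul, map_inv, mul_inv_eq_one, map_mul, map_mul, map_mul, map_tailProd] at h
  exact h

theorem isNilpotentSequence_genSeq (t : ParamIndex n → ℤ) :
    IsNilpotentSequence (genSeq t) n (paramSeq t) where
  tail_zero := by
    rw [eq_top_iff, ← PresentedGroup.closure_range_of (relators t)]
    refine Subgroup.closure_mono ?_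
    rintro _ ⟨k, rfl⟩
    exact ⟨k.1, Nat.zero_le _, genSeq_val t k⟩
  eq_one k hk := dif_neg (Nat.not_lt.mpr hk)
  rel i j hij hj := by
    have h := gen_rel t (i := ⟨i, hij.trans hj⟩) (j := ⟨j, hj⟩) hij
    rw [tailProd_eq (genSeq_val t), ← genSeq_val, ← genSeq_val] at h
    rw [h]
    congr 1
    refine orderedProd_congr fun k hk => ?_
    congr 1
    simp only [extendExponents, paramSeq, hk, hij, dif_pos, Fin.mk_lt_mk, true_and, and_true]
  param_eq_zero i j k hk := dif_neg fun h => by omega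

theorem exists_zpow_mul_of_mem_tail {G : Type*} [Group G] {a : ℕ → G} {t : ℕ → ℕ → ℕ → ℤ}
    (ha : IsNilpotentSequence a n t) (k : ℕ)
    (x : tailSubgroup a k ⧸ (tailSubgroup a (k + 1)).subgroupOf (tailSubgroup a k)) :
    ∃ s : ℤ, QuotientGroup.mk (⟨a k, mem_tailSubgroup le_rfl⟩ ^ s) = x := by
  obtain ⟨⟨r, hr⟩, rfl⟩ := QuotientGroup.mk_surjective x
  obtain ⟨s, hs⟩ := ha.exists_zpow_mul_mem hr
  refine ⟨s, QuotientGroup.eq.mpr ?_⟩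
  rw [Subgroup.mem_subgroupOf]
  simpa using hs

theorem tail_subgroupOf_normal {G : Type*} [Group G] {a : ℕ → G} {t : ℕ → ℕ → ℕ → ℤ}
    (ha : IsNilpotentSequence a n t) (k : ℕ) :
    ((tailSubgroup a (k + 1)).subgroupOf (tailSubgroup a k)).Normal :=
  (ha.tail_normal (k + 1)).comap _

theorem isCyclic_tail_factor {G : Type*} [Group G] {a : ℕ → G} {t : ℕ → ℕ → ℕ → ℤ}
    (ha : IsNilpotentSequence a n t) (k : ℕ)
    [((tailSubgroup a (k + 1)).subgroupOf (tailSubgroup a k)).Normal] :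
    IsCyclic (tailSubgroup a k ⧸ (tailSubgroup a (k + 1)).subgroupOf (tailSubgroup a k)) :=
  ⟨QuotientGroup.mk ⟨a k, mem_tailSubgroup le_rfl⟩, exists_zpow_mul_of_mem_tail ha k⟩

/-- The series of the tail subgroups. -/
def tailSeries {G : Type*} [Group G] {a : ℕ → G} {t : ℕ → ℕ → ℕ → ℤ}
    (ha : IsNilpotentSequence a n t) : CyclicSeries G where
  length := n
  term i := tailSubgroup a i
  term_zero := ha.tail_zero
  term_last := ha.tail_eq_bot le_rfl
  term_le i := tailSubgroup_antitone (Nat.le_succ i)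
  normal i := tail_subgroupOf_normal ha i
  cyclic i := by
    have := tail_subgroupOf_normal ha i
    exact isCyclic_tail_factor ha i

theorem finite_tail_factor {G : Type*} [Group G] {a : ℕ → G} {t : ℕ → ℕ → ℕ → ℤ}
    (ha : IsNilpotentSequence a n t) {k : ℕ} {s : ℤ} (hs : s ≠ 0)
    (h : a k ^ s ∈ tailSubgroup a (k + 1)) :
    Finite (tailSubgroup a k ⧸ (tailSubgroup a (k + 1)).subgroupOf (tailSubgroup a k)) := by
  have := tail_subgroupOf_normal ha k
  let z : tailSubgroup a k ⧸
      (tailSubgroup a (k + 1)).subgroupOf (tailSubgroup a k) := QuotientGroup.mk ⟨a k, mem_tailSubgroup le_rfl⟩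
  have hz : z ^ s = 1 := by
    refine (QuotientGroup.eq_one_iff _).mpr ?_
    rw [Subgroup.mem_subgroupOf]
    simpa using h
  have hfin : IsOfFinOrder z := isOfFinOrder_iff_zpow_eq_one.mpr ⟨s, hs, hz⟩
  have htop : (Subgroup.zpowers z).carrier = Set.univ :=
    Set.eq_univ_of_forall fun x => exists_zpow_mul_of_mem_tail ha k x
  rw [← Set.finite_univ_iff, ← htop]
  exact hfin.finite_zpowers

theorem isConsistentSequence_genSeq {t : ParamIndex n → ℤ} (ht : t ∈ consistentParams n) :
    IsConsistentSequence (genSeq t) n (paramSeq t) where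
  toIsNilpotentSequence := isNilpotentSequence_genSeq t
  zpow_mem k hk s h := by
    by_contra hs
    have ha := isNilpotentSequence_genSeq t
    have hfin := finite_tail_factor ha hs h
    -- As an infimum, the Hirsch length is at most the number of infinite factors of the tail
    -- series. Since that series has only `n` factors, none of them can be finite; invariance of the
    -- Hirsch length is not needed.
    have h1 : n ≤ (tailSeries ha).numInfinite :=
      (show hirschLength (NilpGroup t) = n from ht).symm.le.trans (Nat.sInf_le ⟨_, rfl⟩)
    have h2 : (tailSeries ha).numInfinite < Nat.card (Fin n) := by
      refine Set.ncard_lt_card (s := {i : Fin n | _}) fun hu => ?_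
      have h3 : (⟨k, hk⟩ : Fin n) ∈ (Set.univ : Set (Fin n)) := Set.mem_univ _
      rw [← hu] at h3
      exact not_finite_iff_infinite.mpr h3 hfin
    rw [Nat.card_fin] at h2
    omega

end Presentation

/-! ### The conjugation function `R_{1,2,n}` -/

section Conjugation

variable {n : ℕ}

/-- The commutator `a_2⁻¹ a_1⁻ᵛ a_2 a_1ᵛ`. -/
def conjElement (t : ParamIndex n → ℤ) (v : ℤ) : NilpGroup t :=
  (genSeq t 1)⁻¹ * (genSeq t 0 ^ v)⁻¹ * genSeq t 1 * genSeq t 0 ^ v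

theorem isConjExponents_iff_tailProd (hn : 3 ≤ n) (t : ParamIndex n → ℤ) (v : ℤ)
    (r : {k : Fin n // idxTwo hn < k} → ℤ) :
    IsConjExponents t (idxOne hn) (idxTwo hn) 1 v r ↔
      orderedProd (genSeq t) (extendExponents (idxTwo hn) r) n = conjElement t v := by
  have h0 : gen t (idxOne hn) = genSeq t 0 := (genSeq_val t _).symm
  have h1 : gen t (idxTwo hn) = genSeq t 1 := (genSeq_val t _).symm
  rw [IsConjExponents, tailProd_eq (genSeq_val t), h0, h1, zpow_one, conjElement, mul_assoc,
    mul_assoc _ (genSeq t 1) (genSeq t 0 ^ v), ← mul_inv_rev, eq_inv_mul_iff_mul_eq, ← mul_assoc,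
    eq_comm]

theorem conjElement_mem {t : ParamIndex n → ℤ} (ha : IsNilpotentSequence (genSeq t) n (paramSeq t))
    (v : ℤ) : conjElement t v ∈ tailSubgroup (genSeq t) 2 := by
  have h := Subgroup.inv_mem _ (ha.tail_central (k := 1) (genSeq t 0 ^ v)
    (mem_tailSubgroup le_rfl))
  convert h using 1
  rw [conjElement]
  group

/-- The commutator lies in `U_2` (indices from `0`), so its normal form involves only `a_3, …, a_n`
in the numbering from `1`. Uniqueness of the normal form gives uniqueness of the exponents. -/
theorem isConjExponents_iff_coord (hn : 3 ≤ n) {t : ParamIndex n → ℤ} (ht : t ∈ consistentParams n) (v : ℤ)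
    (r : {k : Fin n // idxTwo hn < k} → ℤ) :
    IsConjExponents t (idxOne hn) (idxTwo hn) 1 v r ↔
      r = fun k => coord (genSeq t) n (conjElement t v) k.1 := by
  have ha := isConsistentSequence_genSeq ht
  rw [isConjExponents_iff_tailProd]
  constructor
  · intro h
    funext k
    rw [← h, ha.coord_orderedProd _ k.1.2]
    simp [extendExponents, k.1.2, k.2]
  · rintro rfl
    conv_rhs => rw [← ha.orderedProd_coord (conjElement t v)]
    refine orderedProd_congr fun i hi => ?_
    congr 1
    simp only [extendExponents, hi, dif_pos]
    split_ifs with h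
    · rfl
    · refine (ha.coord_of_mem_tail (conjElement_mem ha.toIsNilpotentSequence v) ?_).symm
      simp only [idxTwo, Fin.mk_lt_mk] at h
      omega

theorem conjFun_eq_coord (hn : 3 ≤ n) {t : ParamIndex n → ℤ} (ht : t ∈ consistentParams n) (v : ℤ) :
    conjFun t (idxOne hn) (idxTwo hn) 1 v =
      fun k => coord (genSeq t) n (conjElement t v) k.1 :=
  (isConjExponents_iff_coord hn ht v _).mp
    (Classical.epsilon_spec ⟨_, (isConjExponents_iff_coord hn ht v _).mpr rfl⟩)

theorem lastConj_eq_coord (hn : 3 ≤ n) {t : ParamIndex n → ℤ} (ht : t ∈ consistentParams n) (v : ℤ) :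
    lastConj hn t v = coord (genSeq t) n (conjElement t v) (n - 1) := by
  rw [lastConj, conjFun_eq_coord hn ht]
  rfl

theorem lastConj_zero (hn : 3 ≤ n) {t : ParamIndex n → ℤ} (ht : t ∈ consistentParams n) :
    lastConj hn t 0 = 0 := by
  have ha := isConsistentSequence_genSeq ht
  rw [lastConj_eq_coord hn ht]
  refine ha.coord_of_mem_tail (j := n) ?_ (by omega)
  simp [conjElement]

/-- The functions on the consistent parameters that are given by polynomials. -/
noncomputable def evalParams (n : ℕ) :
    MvPolynomial (ParamIndex n) ℚ →ₐ[ℚ] (consistentParams n → ℚ) :=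
  MvPolynomial.aeval fun p t => (t.1 p : ℚ)

theorem evalParams_apply (P : MvPolynomial (ParamIndex n) ℚ) (t : consistentParams n) :
    evalParams n P t = MvPolynomial.eval (fun p => (t.1 p : ℚ)) P := by
  have h : ((Pi.evalRingHom (fun _ => ℚ) t).comp (evalParams n).toRingHom) =
      MvPolynomial.eval fun p => (t.1 p : ℚ) := by
    refine MvPolynomial.ringHom_ext (fun r => ?_) fun p => ?_
    · simp [evalParams]
    · simp [evalParams]
  exact congrArg (fun φ => φ P) h

/-- The family of the groups `G(t)` with consistent `t`. -/
noncomputable def consistentFamily (n : ℕ) : PolyData n where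
  Point := consistentParams n
  alg := (evalParams n).range
  Grp t := NilpGroup t.1
  group t := inferInstance
  seq t := genSeq t.1
  param t := paramSeq t.1
  consistent t := isConsistentSequence_genSeq t.2
  param_mem i j k := by
    by_cases h : i < j ∧ j < k ∧ k < n
    · refine ⟨MvPolynomial.X ⟨(⟨i, by omega⟩, ⟨j, by omega⟩, ⟨k, h.2.2⟩), h.1, h.2.1⟩, ?_⟩
      funext t
      simp [evalParams, paramSeq, h]
    · refine ⟨0, ?_⟩
      funext t
      simp [paramSeq, h]

theorem exists_polynomial_lastConj (hn : 3 ≤ n) : ∃ f : Polynomial (MvPolynomial (ParamIndex n) ℚ),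
    ∀ t ∈ consistentParams n, ∀ v : ℤ, (lastConj hn t v : ℚ) = evalAt f t v := by
  let D := consistentFamily n
  have hmul := fun j => (PolyData.closedAt n j D.ext).1
  have hcl := PolyData.closedAt n
  have h1 : D.ext.IsPoly 0 fun p => D.seq p.1 1 :=
    (PolyData.isPoly_seq (D := D.ext) 1).mono (Nat.zero_le _)
  have h0 : D.ext.IsPoly 0 fun p => D.seq p.1 0 ^ p.2 :=
    PolyData.isPoly_zpow (D := D.ext) _ snd_mem_polyExtension
  have h := hmul 0 _ _ (hmul 0 _ _ (hmul 0 _ _ (PolyData.isPoly_inv (hcl 0) h1)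
    (PolyData.isPoly_inv (hcl 0) h0)) h1) h0
  obtain ⟨P, hP⟩ := h.coord_mem (n - 1)
  -- The coefficients of `P` are only functions on the consistent parameters; each is lifted to a
  -- polynomial in `T` inducing it.
  obtain ⟨f, rfl⟩ := Polynomial.map_surjective (evalParams n).rangeRestrict.toRingHom
    (evalParams n).rangeRestrict_surjective P
  refine ⟨f, fun t ht v => ?_⟩
  rw [lastConj_eq_coord hn ht, evalAt, Polynomial.eval_map]
  refine (hP ⟨t, ht⟩ v).trans ?_
  refine (Polynomial.eval₂_map (evalParams n).rangeRestrict.toRingHom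
    (evalPoint (evalParams n).range ⟨t, ht⟩) (v : ℚ)).trans ?_
  exact congrArg (fun φ => f.eval₂ φ (v : ℚ))
    (RingHom.ext fun Q => evalParams_apply Q ⟨t, ht⟩)

theorem evalAt_comp (f : Polynomial (MvPolynomial (ParamIndex n) ℚ)) (t : ParamIndex n → ℤ)
    (v : ℤ) : evalAt (f.comp (Polynomial.X + 1)) t v = evalAt f t (v + 1) := by
  simp [evalAt, Polynomial.map_comp]

theorem lastConj_eq_of_recursion (hn : 3 ≤ n) {g : Polynomial (MvPolynomial (ParamIndex n) ℚ)}
    {t : ParamIndex n → ℤ} (ht : t ∈ consistentParams n)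
    (hg : ∀ v : ℤ, (lastConj hn t (v + 1) : ℚ) = (lastConj hn t v : ℚ) + evalAt g t v)
    (v : ℤ) : (lastConj hn t v : ℚ) = evalAt (bernoulliSolution 0 g) t v := by
  refine eq_of_differences (φ := fun v => (lastConj hn t v : ℚ))
    (ψ := fun v => evalAt (bernoulliSolution 0 g) t v) ?_ hg (fun v => ?_) v
  · have h := congrArg (MvPolynomial.eval fun p => (t p : ℚ)) (bernoulliSolution_eval_zero 0 g)
    rw [lastConj_zero hn ht, evalAt, Polynomial.eval_map]
    rw [Polynomial.eval, Polynomial.hom_eval₂] at h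
    simpa using h.symm
  · rw [← evalAt_comp, bernoulliSolution_comp]
    simp [evalAt]

end Conjugation

end HallPoly

theorem mainTheorem6 (n : ℕ) (hn : 3 ≤ n) :
    -- the functions `R_{1,2,k}(t;1,v)` are well defined by their defining equation
    (∀ t ∈ HallPoly.consistentParams n, ∀ (v : ℤ)
      (r : {k : Fin n // HallPoly.idxTwo hn < k} → ℤ),
      HallPoly.IsConjExponents t (HallPoly.idxOne hn) (HallPoly.idxTwo hn) 1 v r ↔
        r = HallPoly.conjFun t (HallPoly.idxOne hn) (HallPoly.idxTwo hn) 1 v) ∧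
    -- the recursion
    (∃ g : Polynomial (MvPolynomial (HallPoly.ParamIndex n) ℚ),
      ∀ t ∈ HallPoly.consistentParams n, ∀ v : ℤ,
        (HallPoly.lastConj hn t (v + 1) : ℚ) =
          (HallPoly.lastConj hn t v : ℚ) + HallPoly.evalAt g t v) ∧
    -- the initial value
    (∀ t ∈ HallPoly.consistentParams n, HallPoly.lastConj hn t 0 = 0) ∧
    -- the solution of each such recursion by Bernoulli numbers is a polynomial for `R_{1,2,n}`
    (∀ g : Polynomial (MvPolynomial (HallPoly.ParamIndex n) ℚ),
      (∀ t ∈ HallPoly.consistentParams n, ∀ v : ℤ,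
        (HallPoly.lastConj hn t (v + 1) : ℚ) =
          (HallPoly.lastConj hn t v : ℚ) + HallPoly.evalAt g t v) →
      (HallPoly.bernoulliSolution 0 g).eval 0 = 0 ∧
      (HallPoly.bernoulliSolution 0 g).comp (Polynomial.X + 1) =
        HallPoly.bernoulliSolution 0 g + g ∧
      ∀ t ∈ HallPoly.consistentParams n, ∀ v : ℤ,
        (HallPoly.lastConj hn t v : ℚ) =
          HallPoly.evalAt (HallPoly.bernoulliSolution 0 g) t v) := by
  refine ⟨fun t ht v r => ?_, ?_, fun t ht => HallPoly.lastConj_zero hn ht, fun g hg => ⟨?_, ?_,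
    fun t ht => HallPoly.lastConj_eq_of_recursion hn ht (hg t ht)⟩⟩
  · rw [HallPoly.isConjExponents_iff_coord hn ht, HallPoly.conjFun_eq_coord hn ht]
  · obtain ⟨f, hf⟩ := HallPoly.exists_polynomial_lastConj hn
    refine ⟨f.comp (Polynomial.X + 1) - f, fun t ht v => ?_⟩
    rw [hf t ht, hf t ht, ← HallPoly.evalAt_comp]
    simp [HallPoly.evalAt]
  · exact HallPoly.bernoulliSolution_eval_zero 0 g
  · exact HallPoly.bernoulliSolution_comp 0 g
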